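/- Let $0<\alpha<1$, $\varsigma=\alpha/2$, $m,\varepsilon,L>0$, $M\in\mathbb N$, $M\ge 1$, $h=L/M$. Let $\mathbb V_h$ be the space of real grid functions $v=(v_{ij})$ that are $M$-periodic in both indices, with $\langle v,w\rangle=h^2\sum_{i,j=1}^M v_{ij}w_{ij}$, $\|v\|^2=\langle v,v\rangle$, the five-point Laplacian $\Delta_h v_{ij}=h^{-2}(v_{i+1,j}+v_{i-1,j}+v_{i,j+1}+v_{i,j-1}-4v_{ij})$ and the forward-difference gradient $\nabla_h v_{ij}=h^{-1}(v_{i+1,j}-v_{ij},\,v_{i,j+1}-v_{ij})$. **Potential.** Let $D=\mathrm{Dom}(f)\subseteq\mathbb R$ be open, $\beta>0$, $[-\beta,\beta]\subseteq D$, $f=-F'$ continuously differentiable on $D$, $f(\pm\beta)=0$, $f>0$ on $D\cap(-\infty,-\beta)$, $f<0$ on $D\cap(\beta,\infty)$. Put $E_{1h}[v]=\langle F(v),1\rangle$ and $g_h(v,w)=e^{w}/e^{E_{1h}[v]}$. **Auxiliary function.** Let $V\in C^1(\mathbb R)\cap W^{2,\infty}(\mathbb R)$ with $V(1)=1$, $V'(1)=0$,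 $|V'|\le K_1$, $0\le V\le K_2$ for some constants $K_1,K_2>0$, and $|V(z_1)-1|\le|V(z_2)-1|$ whenever $|z_1-1|\le|z_2-1|$. **Time mesh.** Let $0=t_0<t_1<\dots<t_N$, $\tau_k=t_k-t_{k-1}$, $r_k=\tau_k/\tau_{k-1}$ $(k\ge2)$, $t_{k-\theta}=(1-\theta)t_k+\theta t_{k-1}$, and $w^{k-\varsigma}=(1-\varsigma)w^k+\varsigma w^{k-1}$. With $\omega_\mu(t)=t^{\mu-1}/\Gamma(\mu)$ put $$a^{(n)}_{n-k}=\frac1{\tau_k}\int_{t_{k-1}}^{\min\{t_k,t_{n-\varsigma}\}}\omega_{1-\alpha}(t_{n-\varsigma}-s)\,ds\quad(1\le k\le n),$$ $$b^{(n)}_{n-k}=\frac{2}{\tau_k(\tau_k+\tau_{k+1})}\int_{t_{k-1}}^{t_k}(s-t_{k-1/2})\,\omega_{1-\alpha}(t_{n-\varsigma}-s)\,ds\quad(1\le k\le n-1),$$ $B^{(1)}_0=a^{(1)}_0$, and for $n\ge2$: $B^{(n)}_0=a^{(n)}_0+b^{(n)}_1/r_n$, $B^{(n)}_{n-k}=a^{(n)}_{n-k}+b^{(n)}_{n-k+1}/r_k-b^{(n)}_{n-k}$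 for $2\le k\le n-1$, and $B^{(n)}_{n-1}=a^{(n)}_{n-1}-b^{(n)}_{n-1}$. The $L2$-$1_\sigma$ formula is $\tilde{\mathbb D}^\alpha_\tau w^n=\sum_{k=1}^nB^{(n)}_{n-k}(w^k-w^{k-1})$; moreover $\mathbb D_\tau w^n=(w^n-w^{n-1})/\tau_n$. **Scheme.** Given $\phi^0\in\mathbb V_h$ and $R^0\in\mathbb R$, the $L2$-$1_\sigma$-sESAV scheme with stabilizing constant $\kappa$ consists of $\hat\phi^0=\phi^0$, the predictions $$B^{(1)}_0(\hat\phi^1-\phi^0)=m\big(\varepsilon^2\Delta_h\hat\phi^{1-\varsigma}+f(\hat\phi^{1-\varsigma})\big),\qquad \hat\phi^n=\min\{\max\{(1+r_n)\phi^{n-1}-r_n\phi^{n-2},-\beta\},\beta\}\ (n\ge2),$$ where $\hat\phi^{n-\varsigma}:=(1-\varsigma)\hat\phi^n+\varsigma\phi^{n-1}$ is required to take its values in $D$, and, with $V^{n-\varsigma}:=V(g_h(\hat\phi^{n-\varsigma},R^{n-1}))$, for $1\le n\le N$, $$\tilde{\mathbb D}^\alpha_\tau\phi^n=m\big(\varepsilon^2\Delta_h\phi^{n-\varsigma}+V^{n-\varsigma}f(\hat\phi^{n-\varsigma})-\kappa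 V^{n-\varsigma}(\phi^{n-\varsigma}-\hat\phi^{n-\varsigma})\big),$$ $$\mathbb D_\tau R^n=V^{n-\varsigma}\big\langle -f(\hat\phi^{n-\varsigma})+\kappa(\phi^{n-\varsigma}-\hat\phi^{n-\varsigma}),\,\mathbb D_\tau\phi^n\big\rangle .$$ **Theorem.** Assume $\kappa\ge\max_{[-\beta,\beta]}|f'|$, $r_k\ge 4/7$ for $2\le k\le N$, and $$\tau_1\le\Big(\frac{4}{11\,\varsigma\, m\,(\kappa+4\varepsilon^2/h^2)\,\Gamma(2-\alpha)}\Big)^{1/\alpha},\qquad \tau_1\le\Big(\frac{4}{11\,\kappa\,(1-\varsigma)\,m\,\Gamma(2-\alpha)}\Big)^{1/\alpha}$$ (the second condition being void if $\kappa=0$). Then every solution of the scheme satisfies $$\mathcal E_h[\phi^n,R^n]\le\mathcal E_h[\phi^0,R^0],\quad 1\le n\le N,\qquad\text{where}\quad \mathcal E_h[\phi,R]=\tfrac{\varepsilon^2}{2}\|\nabla_h\phi\|^2+R .$$ -/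

import Mathlib

noncomputable section

namespace TFAC

/-! ### The nonlinear potential and the auxiliary function -/

/-- `F` is a potential on the open set `D = Dom f` with `f = -F'` continuously differentiable,
`f (±β) = 0`, `f > 0` on `D` to the left of `-β` and `f < 0` on `D` to the right of `β`.
The values of `F` and `f` outside `D` are irrelevant. -/
structure IsPotential (F f : ℝ → ℝ) (D : Set ℝ) (β : ℝ) : Prop where
  isOpen_dom : IsOpen D
  beta_pos : 0 < β
  Icc_subset_dom : Set.Icc (-β) β ⊆ D
  hasDerivAt : ∀ x ∈ D, HasDerivAt F (-f x) x
  contDiffOn : ContDiffOn ℝ 1 f D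
  zero_right : f β = 0
  zero_left : f (-β) = 0
  pos_left : ∀ x ∈ D, x < -β → 0 < f x
  neg_right : ∀ x ∈ D, β < x → f x < 0

/-- `v` is the weak derivative of `u` on the real line. -/
def HasWeakDeriv (u v : ℝ → ℝ) : Prop :=
  MeasureTheory.LocallyIntegrable u ∧ MeasureTheory.LocallyIntegrable v ∧
    ∀ ψ : ℝ → ℝ, ContDiff ℝ (⊤ : ℕ∞) ψ → HasCompactSupport ψ →
      ∫ x, u x * deriv ψ x = -∫ x, v x * ψ x

/-- The Sobolev space `W^{2,∞}(ℝ)`. -/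
def MemW2Infty (u : ℝ → ℝ) : Prop :=
  ∃ v w : ℝ → ℝ, MeasureTheory.MemLp u ⊤ ∧ MeasureTheory.MemLp v ⊤ ∧ MeasureTheory.MemLp w ⊤ ∧
    HasWeakDeriv u v ∧ HasWeakDeriv v w

/-- The assumptions (A1), (A2), (A3) on the auxiliary function `V`. -/
structure IsAuxiliary (V : ℝ → ℝ) (K₁ K₂ : ℝ) : Prop where
  K₁_pos : 0 < K₁
  K₂_pos : 0 < K₂
  contDiff : ContDiff ℝ 1 V
  memW2Infty : MemW2Infty V
  map_one : V 1 = 1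
  deriv_one : deriv V 1 = 0
  abs_deriv_le : ∀ z, |deriv V z| ≤ K₁
  nonneg : ∀ z, 0 ≤ V z
  le_bound : ∀ z, V z ≤ K₂
  monotone : ∀ z₁ z₂, |z₁ - 1| ≤ |z₂ - 1| → |V z₁ - 1| ≤ |V z₂ - 1|

/-! ### Periodic grid functions -/

/-- `M`-periodic real grid functions in two dimensions, as functions on `(ℤ/Mℤ)²`. -/
abbrev Grid (M : ℕ) : Type := ZMod M → ZMod M → ℝ

section Grid

variable {M : ℕ} [NeZero M]

/-- `⟨v, w⟩ = h² ∑ᵢⱼ vᵢⱼ wᵢⱼ`. -/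
def gridInner (h : ℝ) (v w : Grid M) : ℝ := h ^ 2 * ∑ i, ∑ j, v i j * w i j

/-- The five-point periodic discrete Laplacian. -/
def gridLaplacian (h : ℝ) (v : Grid M) : Grid M := fun i j =>
  (v (i + 1) j + v (i - 1) j + v i (j + 1) + v i (j - 1) - 4 * v i j) / h ^ 2

/-- First component of the discrete gradient. -/
def gridGradX (h : ℝ) (v : Grid M) : Grid M := fun i j => (v (i + 1) j - v i j) / h

/-- Second component of the discrete gradient. -/
def gridGradY (h : ℝ) (v : Grid M) : Grid M := fun i j => (v i (j + 1) - v i j) / h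

/-- `‖∇ₕ v‖`, the discrete `L²` norm of the discrete gradient. -/
def gridGradNorm (h : ℝ) (v : Grid M) : ℝ :=
  Real.sqrt (gridInner h (gridGradX h v) (gridGradX h v) +
    gridInner h (gridGradY h v) (gridGradY h v))

/-- Pointwise application of a real function to a grid function. -/
def gridMap (f : ℝ → ℝ) (v : Grid M) : Grid M := fun i j => f (v i j)

/-- `E₁ₕ[v] = ⟨F(v), 1⟩`. -/
def potentialEnergy (F : ℝ → ℝ) (h : ℝ) (v : Grid M) : ℝ :=
  gridInner h (gridMap F v) (fun _ _ => 1)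

/-- `gₕ(v, w) = exp w / exp E₁ₕ[v]`. -/
def gFun (F : ℝ → ℝ) (h : ℝ) (v : Grid M) (w : ℝ) : ℝ :=
  Real.exp w / Real.exp (potentialEnergy F h v)

/-- The modified discrete energy `ε²/2 ‖∇ₕ φ‖² + R`. -/
def energy (ε h : ℝ) (φ : Grid M) (R : ℝ) : ℝ := ε ^ 2 / 2 * gridGradNorm h φ ^ 2 + R

/-- The truncated linear extrapolation
`min {max {(1 + r) φ₁ - r φ₂, -β}, β}`, pointwise (`φ₁` is the later of the two levels). -/
def clippedExtrapolation (β r : ℝ) (φ₁ φ₂ : Grid M) : Grid M := fun i j =>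
  min (max ((1 + r) * φ₁ i j - r * φ₂ i j) (-β)) β

/-- `(1 - ς) v + ς w`, the weighted value at an off-set time level. -/
def weighted (ς : ℝ) (v w : Grid M) : Grid M := fun i j => (1 - ς) * v i j + ς * w i j

end Grid

/-! ### The nonuniform `L2-1_σ` formula with `ς = α / 2`

Time meshes are sequences `t : ℕ → ℝ` of which only `t 0 < t 1 < ⋯ < t N` matter.
The kernels with upper index `(n)` and lower index `n - k` are written as functions of `n k`. -/

/-- `ω_μ(t) = t^(μ-1) / Γ(μ)`. -/
def omega (μ t : ℝ) : ℝ := t ^ (μ - 1) / Real.Gamma μ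

/-- `τ_k = t_k - t_{k-1}` for `k ≥ 1`. -/
def step (t : ℕ → ℝ) (k : ℕ) : ℝ := t k - t (k - 1)

/-- `r_k = τ_k / τ_{k-1}` for `k ≥ 2`. -/
def ratio (t : ℕ → ℝ) (k : ℕ) : ℝ := step t k / step t (k - 1)

/-- `t_{k-ς} = (1 - ς) t_k + ς t_{k-1}` for `k ≥ 1`. -/
def offset (ς : ℝ) (t : ℕ → ℝ) (k : ℕ) : ℝ := (1 - ς) * t k + ς * t (k - 1)

/-- `a^{(n)}_{n-k}`, for `1 ≤ k ≤ n`. -/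
def coeffA (α : ℝ) (t : ℕ → ℝ) (n k : ℕ) : ℝ :=
  1 / step t k * ∫ s in (t (k - 1))..(min (t k) (offset (α / 2) t n)),
    omega (1 - α) (offset (α / 2) t n - s)

/-- `b^{(n)}_{n-k}`, for `1 ≤ k ≤ n - 1`. -/
def coeffB (α : ℝ) (t : ℕ → ℝ) (n k : ℕ) : ℝ :=
  2 / (step t k * (step t k + step t (k + 1))) * ∫ s in (t (k - 1))..(t k),
    (s - offset (1 / 2) t k) * omega (1 - α) (offset (α / 2) t n - s)

/-- The discrete convolution kernel `B^{(n)}_{n-k}`, for `1 ≤ k ≤ n`. -/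
def kernel (α : ℝ) (t : ℕ → ℝ) (n k : ℕ) : ℝ :=
  if n = 1 then coeffA α t 1 1
  else if k = n then coeffA α t n n + coeffB α t n (n - 1) / ratio t n
  else if k = 1 then coeffA α t n 1 - coeffB α t n 1
  else coeffA α t n k + coeffB α t n (k - 1) / ratio t k - coeffB α t n k

/-- The `L2-1_σ` approximation `∑_{k=1}^n B^{(n)}_{n-k} (w^k - w^{k-1})` of the Caputo derivative
of order `α` at `t_{n-ς}`. -/
def caputoL21 {M : ℕ} (α : ℝ) (t : ℕ → ℝ) (w : ℕ → Grid M) (n : ℕ) : Grid M :=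
  ∑ k ∈ Finset.Icc 1 n, kernel α t n k • (w k - w (k - 1))

/-! ### The scheme -/

/-- `(φhat, φ, R)` is a solution, on the time levels `0, …, N`, of the (balanced) stabilized
`L2-1_σ`-sESAV scheme with `ς = α / 2`. The field `mem_dom` expresses that the scheme only
makes sense if the arguments at which `f` and `F` are evaluated lie in `D = Dom f`. -/
structure IsSolution {M : ℕ} [NeZero M] (α m ε κ β h : ℝ) (F f : ℝ → ℝ) (D : Set ℝ) (V : ℝ → ℝ)
    (N : ℕ) (t : ℕ → ℝ) (φhat φ : ℕ → Grid M) (R : ℕ → ℝ) : Prop where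
  hat_zero : φhat 0 = φ 0
  mem_dom : ∀ n, 1 ≤ n → n ≤ N → ∀ i j, weighted (α / 2) (φhat n) (φ (n - 1)) i j ∈ D
  predict_first : 1 ≤ N →
    kernel α t 1 1 • (φhat 1 - φ 0) =
      m • (ε ^ 2 • gridLaplacian h (weighted (α / 2) (φhat 1) (φ 0)) +
        gridMap f (weighted (α / 2) (φhat 1) (φ 0)))
  predict : ∀ n, 2 ≤ n → n ≤ N →
    φhat n = clippedExtrapolation β (ratio t n) (φ (n - 1)) (φ (n - 2))
  phase : ∀ n, 1 ≤ n → n ≤ N →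
    let φς := weighted (α / 2) (φ n) (φ (n - 1))
    let φhatς := weighted (α / 2) (φhat n) (φ (n - 1))
    let Vς := V (gFun F h φhatς (R (n - 1)))
    caputoL21 α t φ n =
      m • (ε ^ 2 • gridLaplacian h φς + Vς • gridMap f φhatς - (κ * Vς) • (φς - φhatς))
  auxiliary : ∀ n, 1 ≤ n → n ≤ N →
    let φς := weighted (α / 2) (φ n) (φ (n - 1))
    let φhatς := weighted (α / 2) (φhat n) (φ (n - 1))
    let Vς := V (gFun F h φhatς (R (n - 1)))
    (R n - R (n - 1)) / step t n =
      Vς * gridInner h (-gridMap f φhatς + κ • (φς - φhatς))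
        ((1 / step t n) • (φ n - φ (n - 1)))

end TFAC

end

namespace TFAC

/-! ### Quadratic forms with lower triangular kernels -/

/-! Test the phase equation with `φ n - φ (n - 1)`. The nonlinear and stabilizing terms carry the
same factor `V` as in the update of `R`, so they produce exactly the increment of `R`. The Laplacian
term bounds the increment of the gradient energy because the weight satisfies `α / 2 ≤ 1 / 2`. Hence
each step raises the energy by at most `-1/m` times the discrete Caputo derivative tested with the
increment (`IsSolution.energy_sub_le`), and after summation the theorem reduces to positive
semidefiniteness of the kernel (`kernel_form_nonneg`).

That property is proved by telescoping squares of tail sums (`triangular_form_nonneg`). With the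
diagonal doubled, the differences along the rows must decrease from one row to the next, and those
of the last row must be nonnegative. Off the diagonal a kernel entry is a linear functional
`incrementCoeff t k` of the singular weight. For monotone convex integrands its value lies between
those at `t (k - 1)` and `t k`, so consecutive coefficients are ordered. Applied to one weight this
gives nonnegativity of row differences; applied to the difference of two consecutive weights, again
monotone and convex, it gives decrease along columns. The diagonal needs explicit integrals and the
power inequality `rpow_four_sevenths_le`. -/

theorem sum_mul_sq_tail_sub (d δ : ℕ → ℝ) (n : ℕ) :
    ∑ k ∈ Finset.Icc 1 (n + 1), d k * (∑ j ∈ Finset.Icc k (n + 1), δ j) ^ 2 -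
        ∑ k ∈ Finset.Icc 1 n, d k * (∑ j ∈ Finset.Icc k n, δ j) ^ 2 =
      2 * (∑ k ∈ Finset.Icc 1 (n + 1), (∑ j ∈ Finset.Icc 1 k, d j) * δ k) * δ (n + 1) -
        (∑ j ∈ Finset.Icc 1 (n + 1), d j) * δ (n + 1) ^ 2 := by
  have hswap : ∑ k ∈ Finset.Icc 1 (n + 1), (∑ j ∈ Finset.Icc 1 k, d j) * δ k =
      ∑ k ∈ Finset.Icc 1 (n + 1), d k * ∑ j ∈ Finset.Icc k (n + 1), δ j := by
    simp_rw [Finset.sum_mul, Finset.mul_sum]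
    apply Finset.sum_comm'
    intro x y
    simp only [Finset.mem_Icc]
    omega
  -- An old tail sum is the new one, `T`, minus `δ (n + 1)`, and the added index `n + 1` contributes
  -- zero. The claim then holds termwise from `T² - (T - δ)² = 2Tδ - δ²`.
  have htail : ∑ k ∈ Finset.Icc 1 n, d k * (∑ j ∈ Finset.Icc k n, δ j) ^ 2 =
      ∑ k ∈ Finset.Icc 1 (n + 1), d k * (∑ j ∈ Finset.Icc k (n + 1), δ j - δ (n + 1)) ^ 2 := by
    rw [Finset.sum_Icc_succ_top (by omega : 1 ≤ n + 1)]
    simp only [Finset.Icc_self, Finset.sum_singleton, sub_self]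
    rw [zero_pow two_ne_zero, mul_zero, add_zero]
    refine Finset.sum_congr rfl fun k hk => ?_
    rw [Finset.mem_Icc] at hk
    rw [Finset.sum_Icc_succ_top (by omega : k ≤ n + 1), add_sub_cancel_right]
  rw [htail, hswap, Finset.mul_sum, Finset.sum_mul, Finset.sum_mul, ← Finset.sum_sub_distrib,
    ← Finset.sum_sub_distrib]
  refine Finset.sum_congr rfl fun k _ => ?_
  ring

/-- A lower triangular kernel is positive semidefinite as soon as the differences `d` along its
rows (after doubling the diagonal) are nonnegative and decrease along the columns. -/
theorem triangular_form_nonneg (N : ℕ) (B d : ℕ → ℕ → ℝ) (δ : ℕ → ℝ)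
    (hB : ∀ n, 1 ≤ n → n ≤ N → ∀ k, 1 ≤ k → k < n → ∑ j ∈ Finset.Icc 1 k, d n j = B n k)
    (hdiag : ∀ n, 1 ≤ n → n ≤ N → ∑ j ∈ Finset.Icc 1 n, d n j = 2 * B n n)
    (hdec : ∀ n k, 1 ≤ k → k ≤ n → n < N → d (n + 1) k ≤ d n k)
    (hpos : ∀ k, 1 ≤ k → k ≤ N → 0 ≤ d N k) :
    0 ≤ ∑ n ∈ Finset.Icc 1 N, (∑ k ∈ Finset.Icc 1 n, B n k * δ k) * δ n := by
  -- The induction needs no sign of `d`: replacing row `n` by row `n + 1` only lowers the weights of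
  -- the squares. Signs enter once, for the last row.
  have key : ∀ n, n ≤ N → ∑ k ∈ Finset.Icc 1 n, d n k * (∑ j ∈ Finset.Icc k n, δ j) ^ 2 ≤
      2 * ∑ p ∈ Finset.Icc 1 n, (∑ k ∈ Finset.Icc 1 p, B p k * δ k) * δ p := by
    intro n
    induction n with
    | zero => simp
    | succ n ih =>
      intro hn
      have h1 := ih (by omega)
      have h2 : ∑ k ∈ Finset.Icc 1 n, d (n + 1) k * (∑ j ∈ Finset.Icc k n, δ j) ^ 2 ≤
          ∑ k ∈ Finset.Icc 1 n, d n k * (∑ j ∈ Finset.Icc k n, δ j) ^ 2 := by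
        refine Finset.sum_le_sum fun k hk => ?_
        rw [Finset.mem_Icc] at hk
        exact mul_le_mul_of_nonneg_right (hdec n k hk.1 hk.2 (by omega)) (sq_nonneg _)
      have h3 := sum_mul_sq_tail_sub (d (n + 1)) δ n
      -- The extra diagonal entry caused by doubling cancels against the `δ (n + 1) ^ 2` term of the
      -- telescoping identity.
      have h4 : ∑ k ∈ Finset.Icc 1 (n + 1), (∑ j ∈ Finset.Icc 1 k, d (n + 1) j) * δ k =
          ∑ k ∈ Finset.Icc 1 (n + 1), B (n + 1) k * δ k + B (n + 1) (n + 1) * δ (n + 1) := by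
        rw [Finset.sum_Icc_succ_top (by omega : 1 ≤ n + 1),
          Finset.sum_Icc_succ_top (by omega : 1 ≤ n + 1) fun k => B (n + 1) k * δ k,
          hdiag (n + 1) (by omega) hn]
        have : ∑ k ∈ Finset.Icc 1 n, (∑ j ∈ Finset.Icc 1 k, d (n + 1) j) * δ k =
            ∑ k ∈ Finset.Icc 1 n, B (n + 1) k * δ k := by
          refine Finset.sum_congr rfl fun k hk => ?_
          rw [Finset.mem_Icc] at hk
          rw [hB (n + 1) (by omega) hn k hk.1 (by omega)]
        rw [this]
        ring
      rw [h4, hdiag (n + 1) (by omega) hn] at h3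
      rw [Finset.sum_Icc_succ_top (by omega : 1 ≤ n + 1)
        fun p => (∑ k ∈ Finset.Icc 1 p, B p k * δ k) * δ p]
      linarith
  have h1 := key N le_rfl
  have h2 : 0 ≤ ∑ k ∈ Finset.Icc 1 N, d N k * (∑ j ∈ Finset.Icc k N, δ j) ^ 2 := by
    refine Finset.sum_nonneg fun k hk => ?_
    rw [Finset.mem_Icc] at hk
    exact mul_nonneg (hpos k hk.1 hk.2) (sq_nonneg _)
  linarith

/-! ### Averages and first moments of monotone convex functions -/

theorem integral_sub_midpoint (u v : ℝ) : ∫ s in u..v, (s - (u + v) / 2) = 0 := by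
  rw [intervalIntegral.integral_sub (by simp) (by simp)]
  simp
  ring

theorem integral_sub_midpoint_sq (u v : ℝ) :
    ∫ s in u..v, (s - (u + v) / 2) ^ 2 = (v - u) ^ 3 / 12 := by
  rw [intervalIntegral.integral_comp_sub_right (fun s => s ^ 2), integral_pow]
  push_cast
  ring

theorem integral_sub_midpoint_mul (u v c : ℝ) {φ : ℝ → ℝ} (huv : u ≤ v)
    (hc : ContinuousOn φ (Set.Icc u v)) :
    ∫ s in u..v, (s - (u + v) / 2) * φ s = ∫ s in u..v, (s - (u + v) / 2) * (φ s - c) := by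
  have hi : IntervalIntegrable (fun s => (s - (u + v) / 2) * φ s) MeasureTheory.volume u v :=
    ContinuousOn.intervalIntegrable_of_Icc huv (by fun_prop)
  have hj : IntervalIntegrable (fun s : ℝ => (s - (u + v) / 2) * c) MeasureTheory.volume u v :=
    Continuous.intervalIntegrable (by fun_prop) _ _
  simp_rw [mul_sub]
  rw [intervalIntegral.integral_sub hi hj, intervalIntegral.integral_mul_const,
    integral_sub_midpoint]
  simp

/-- The weight has mean zero, so the midpoint value of `φ` may be subtracted; both factors then have
the same sign. -/
theorem moment_nonneg {u v : ℝ} {φ : ℝ → ℝ} (huv : u ≤ v) (hc : ContinuousOn φ (Set.Icc u v))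
    (hm : MonotoneOn φ (Set.Icc u v)) : 0 ≤ ∫ s in u..v, (s - (u + v) / 2) * φ s := by
  rw [integral_sub_midpoint_mul u v (φ ((u + v) / 2)) huv hc]
  refine intervalIntegral.integral_nonneg huv fun s hs => ?_
  have hmid : (u + v) / 2 ∈ Set.Icc u v := ⟨by linarith, by linarith⟩
  rcases le_total s ((u + v) / 2) with h | h
  · exact mul_nonneg_of_nonpos_of_nonpos (by linarith) (by linarith [hm hs hmid h])
  · exact mul_nonneg (by linarith) (by linarith [hm hmid hs h])

theorem moment_le {u v D : ℝ} {φ : ℝ → ℝ} (huv : u ≤ v) (hc : ContinuousOn φ (Set.Icc u v))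
    (hD : ∀ x ∈ Set.Icc u v, ∀ y ∈ Set.Icc u v, x ≤ y → φ y - φ x ≤ D * (y - x)) :
    ∫ s in u..v, (s - (u + v) / 2) * φ s ≤ D * (v - u) ^ 3 / 12 := by
  rw [integral_sub_midpoint_mul u v (φ ((u + v) / 2)) huv hc, mul_div_assoc,
    ← integral_sub_midpoint_sq, ← intervalIntegral.integral_const_mul]
  refine intervalIntegral.integral_mono_on huv
    (ContinuousOn.intervalIntegrable_of_Icc huv (by fun_prop))
    (Continuous.intervalIntegrable (by fun_prop) _ _) fun s hs => ?_
  have hmid : (u + v) / 2 ∈ Set.Icc u v := ⟨by linarith, by linarith⟩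
  rcases le_total s ((u + v) / 2) with h | h
  · nlinarith [hD s hs _ hmid h]
  · nlinarith [hD _ hmid s hs h]

theorem integral_le_trapezoid {u v : ℝ} {φ : ℝ → ℝ} (huv : u < v)
    (hc : ContinuousOn φ (Set.Icc u v)) (hconv : ConvexOn ℝ (Set.Icc u v) φ) :
    ∫ s in u..v, φ s ≤ (v - u) * ((φ u + φ v) / 2) := by
  have hline : ∫ s in u..v, ((φ u + φ v) / 2 + (s - (u + v) / 2) * ((φ v - φ u) / (v - u))) =
      (v - u) * ((φ u + φ v) / 2) := by
    rw [intervalIntegral.integral_add (by simp)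
      (Continuous.intervalIntegrable (by fun_prop) _ _), intervalIntegral.integral_mul_const,
      integral_sub_midpoint]
    simp
    ring
  rw [← hline]
  refine intervalIntegral.integral_mono_on huv.le (hc.intervalIntegrable_of_Icc huv.le)
    (Continuous.intervalIntegrable (by fun_prop) _ _) fun s hs => ?_
  have hvu : 0 < v - u := by linarith
  have h := hconv.2 (Set.left_mem_Icc.2 huv.le) (Set.right_mem_Icc.2 huv.le)
    (div_nonneg (sub_nonneg.2 hs.2) hvu.le) (div_nonneg (sub_nonneg.2 hs.1) hvu.le)
    (by field_simp; ring)
  simp only [smul_eq_mul] at h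
  have hs' : (v - s) / (v - u) * u + (s - u) / (v - u) * v = s := by field_simp; ring
  rw [hs'] at h
  refine h.trans (le_of_eq ?_)
  field_simp
  ring

/-! ### Local coefficients of the quadratic interpolation for a general integrand -/

/-- The average of `φ` over the `k`-th subinterval. -/
noncomputable def average (t : ℕ → ℝ) (k : ℕ) (φ : ℝ → ℝ) : ℝ :=
  1 / step t k * ∫ s in (t (k - 1))..(t k), φ s

/-- The weighted first moment of `φ` over the `k`-th subinterval. -/
noncomputable def moment (t : ℕ → ℝ) (k : ℕ) (φ : ℝ → ℝ) : ℝ :=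
  2 / (step t k * (step t k + step t (k + 1))) * ∫ s in (t (k - 1))..(t k),
    (s - (t (k - 1) + t k) / 2) * φ s

/-- The coefficient of the `k`-th increment in the `L2-1_σ` formula, the weakly singular kernel
being replaced by `φ`. -/
noncomputable def incrementCoeff (t : ℕ → ℝ) (k : ℕ) (φ : ℝ → ℝ) : ℝ :=
  average t k φ + (if k = 1 then 0 else moment t (k - 1) φ / ratio t k) - moment t k φ

section LocalCoefficients

variable {t : ℕ → ℝ} {φ χ : ℝ → ℝ}

theorem average_sub {k : ℕ} (hk : t (k - 1) ≤ t k)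
    (hφ : ContinuousOn φ (Set.Icc (t (k - 1)) (t k)))
    (hχ : ContinuousOn χ (Set.Icc (t (k - 1)) (t k))) :
    average t k (fun s => φ s - χ s) = average t k φ - average t k χ := by
  unfold average
  rw [intervalIntegral.integral_sub (hφ.intervalIntegrable_of_Icc hk)
    (hχ.intervalIntegrable_of_Icc hk), mul_sub]

theorem moment_sub {k : ℕ} (hk : t (k - 1) ≤ t k)
    (hφ : ContinuousOn φ (Set.Icc (t (k - 1)) (t k)))
    (hχ : ContinuousOn χ (Set.Icc (t (k - 1)) (t k))) :
    moment t k (fun s => φ s - χ s) = moment t k φ - moment t k χ := by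
  unfold moment
  simp_rw [mul_sub]
  rw [intervalIntegral.integral_sub, mul_sub]
  · exact ContinuousOn.intervalIntegrable_of_Icc hk (by fun_prop)
  · exact ContinuousOn.intervalIntegrable_of_Icc hk (by fun_prop)

theorem weighted_moment_nonneg {k : ℕ} (hk : 0 < step t k) (hk' : 0 < step t (k + 1))
    (hφ : ContinuousOn φ (Set.Icc (t (k - 1)) (t k)))
    (hm : MonotoneOn φ (Set.Icc (t (k - 1)) (t k))) : 0 ≤ moment t k φ := by
  have : t (k - 1) ≤ t k := by unfold step at hk; linarith
  exact mul_nonneg (by positivity) (moment_nonneg this hφ hm)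

/-- The combination is an integral of `φ` against a density of total mass one. The density is
nonnegative since `s` exceeds the midpoint by at most half a step, so a monotone `φ` is bounded
below by its left endpoint value. -/
theorem le_average_sub_moment {k : ℕ} (hk : 0 < step t k) (hk' : 0 < step t (k + 1))
    (hφ : ContinuousOn φ (Set.Icc (t (k - 1)) (t k)))
    (hm : MonotoneOn φ (Set.Icc (t (k - 1)) (t k))) :
    φ (t (k - 1)) ≤ average t k φ - moment t k φ := by
  unfold average moment
  generalize step t (k + 1) = y at *
  have hle : t (k - 1) ≤ t k := by unfold step at hk; linarith
  have hk0 : step t k = t k - t (k - 1) := rfl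
  generalize step t k = x at *
  generalize t (k - 1) = u at *
  generalize t k = v at *
  have hi : IntervalIntegrable (fun s => (s - (u + v) / 2) * φ s) MeasureTheory.volume u v :=
    ContinuousOn.intervalIntegrable_of_Icc hle (by fun_prop)
  have hw : ∫ s in u..v, (1 - 2 / (x + y) * (s - (u + v) / 2)) * φ u = x * φ u := by
    rw [intervalIntegral.integral_mul_const, intervalIntegral.integral_sub (by simp)
      (Continuous.intervalIntegrable (by fun_prop) _ _), intervalIntegral.integral_const_mul,
      integral_sub_midpoint]
    simp [hk0]
  have hsplit : ∫ s in u..v, (1 - 2 / (x + y) * (s - (u + v) / 2)) * φ s =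
      (∫ s in u..v, φ s) - 2 / (x + y) * ∫ s in u..v, (s - (u + v) / 2) * φ s := by
    rw [← intervalIntegral.integral_const_mul, ← intervalIntegral.integral_sub
      (hφ.intervalIntegrable_of_Icc hle) (hi.const_mul _)]
    refine intervalIntegral.integral_congr fun s _ => ?_
    ring
  have hmono : x * φ u ≤ ∫ s in u..v, (1 - 2 / (x + y) * (s - (u + v) / 2)) * φ s := by
    rw [← hw]
    refine intervalIntegral.integral_mono_on hle
      (Continuous.intervalIntegrable (by fun_prop) _ _)
      (ContinuousOn.intervalIntegrable_of_Icc hle (by fun_prop)) fun s hs => ?_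
    refine mul_le_mul_of_nonneg_left (hm (Set.left_mem_Icc.2 hle) hs hs.1) ?_
    rw [sub_nonneg, div_mul_eq_mul_div, div_le_one (by positivity)]
    linarith [hs.2]
  rw [hsplit] at hmono
  have : 1 / x * (∫ s in u..v, φ s) - 2 / (x * (x + y)) * (∫ s in u..v, (s - (u + v) / 2) * φ s) =
      ((∫ s in u..v, φ s) - 2 / (x + y) * ∫ s in u..v, (s - (u + v) / 2) * φ s) / x := by
    field_simp
  rw [this, le_div_iff₀ hk]
  linarith

theorem average_le {k : ℕ} (hk : 0 < step t k)
    (hφ : ContinuousOn φ (Set.Icc (t (k - 1)) (t k)))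
    (hm : MonotoneOn φ (Set.Icc (t (k - 1)) (t k))) : average t k φ ≤ φ (t k) := by
  unfold average
  have hle : t (k - 1) ≤ t k := by unfold step at hk; linarith
  rw [one_div, inv_mul_le_iff₀ hk]
  have h := intervalIntegral.integral_mono_on hle (hφ.intervalIntegrable_of_Icc hle)
    (intervalIntegrable_const (c := φ (t k)) (μ := MeasureTheory.volume)) fun s hs => hm hs (Set.right_mem_Icc.2 hle) hs.2
  simpa [step] using h

/-- With `v < w` the endpoints of the last cell, the trapezoidal rule bounds the average by `(φ v +
φ w) / 2`. Convexity bounds slopes on the previous cell by that of the chord from `v` to `w`, so the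
scaled moment is at most `(φ w - φ v) / 2`, and the two bounds add up to `φ w`. -/
theorem average_add_moment_le {k : ℕ} (hk : 0 < step t (k + 1)) (hk' : 0 < step t (k + 2))
    (hr : 4 / 7 ≤ ratio t (k + 2))
    (hφ : ContinuousOn φ (Set.Icc (t k) (t (k + 2))))
    (hm : MonotoneOn φ (Set.Icc (t k) (t (k + 2))))
    (hconv : ConvexOn ℝ (Set.Icc (t k) (t (k + 2))) φ) :
    average t (k + 2) φ + moment t (k + 1) φ / ratio t (k + 2) ≤ φ (t (k + 2)) := by
  unfold average moment ratio at *
  simp only [show k + 2 - 1 = k + 1 from rfl, show k + 1 - 1 = k from rfl,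
    show k + 1 + 1 = k + 2 from rfl] at *
  have hx : step t (k + 1) = t (k + 1) - t k := rfl
  have hz : step t (k + 2) = t (k + 2) - t (k + 1) := rfl
  generalize step t (k + 1) = x at *
  generalize step t (k + 2) = z at *
  generalize t k = u at *
  generalize t (k + 1) = v at *
  generalize t (k + 2) = w at *
  have huv : u ≤ v := by linarith
  have hvw : v < w := by linarith
  have hsub : Set.Icc u v ⊆ Set.Icc u w := Set.Icc_subset_Icc_right hvw.le
  have hsub' : Set.Icc v w ⊆ Set.Icc u w := Set.Icc_subset_Icc_left huv
  have h1 := integral_le_trapezoid hvw (hφ.mono hsub') (hconv.subset hsub' (convex_Icc v w))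
  have hv : v ∈ Set.Icc u w := ⟨huv, hvw.le⟩
  have hw : w ∈ Set.Icc u w := ⟨by linarith, le_rfl⟩
  have hD : ∀ a ∈ Set.Icc u v, ∀ b ∈ Set.Icc u v, a ≤ b →
      φ b - φ a ≤ (φ w - φ v) / z * (b - a) := by
    intro a ha b hb hab
    rcases hab.eq_or_lt with rfl | hab
    · simp
    have hbw : (φ b - φ a) / (b - a) ≤ (φ w - φ b) / (w - b) :=
      hconv.slope_mono_adjacent (hsub ha) hw hab (by linarith [hb.2])
    have hle : (φ w - φ b) / (w - b) ≤ (φ w - φ v) / z := by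
      rcases hb.2.eq_or_lt with rfl | hbv
      · rw [hz]
      have h := hconv.secant_mono hw (hsub hb) hv (by linarith) (by linarith) hb.2
      rw [hz, ← neg_div_neg_eq, neg_sub, neg_sub, ← neg_div_neg_eq (φ w - φ v), neg_sub, neg_sub]
      exact h
    rw [← div_le_iff₀ (by linarith)]
    exact hbw.trans hle
  have h2 := moment_le huv (hφ.mono hsub) hD
  have hmono : 0 ≤ φ w - φ v := sub_nonneg.2 (hm hv hw hvw.le)
  rw [← hx] at h2
  rw [← hz] at h1
  have hxz : 4 * x ≤ 7 * z := by
    rw [div_le_div_iff₀ (by norm_num) hk] at hr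
    linarith
  -- From `x ≤ 7z/4`, the left side is at most `(49/16) z²x` and the right side at least `(33/7)
  -- z²x`.
  have hcube : x ^ 3 ≤ 3 * z ^ 2 * (x + z) := by
    nlinarith [mul_nonneg (sub_nonneg.2 hxz) (mul_pos hk hk).le,
      mul_nonneg (sub_nonneg.2 hxz) (mul_pos hk hk').le, pow_pos hk' 3, mul_pos hk (mul_pos hk' hk'),
      mul_nonneg (sub_nonneg.2 hxz) (mul_pos hk' hk').le]
  have hmom : 2 / (x * (x + z)) * (∫ s in u..v, (s - (u + v) / 2) * φ s) / (z / x) ≤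
      (φ w - φ v) / 2 := by
    calc 2 / (x * (x + z)) * (∫ s in u..v, (s - (u + v) / 2) * φ s) / (z / x)
        ≤ 2 / (x * (x + z)) * ((φ w - φ v) / z * x ^ 3 / 12) / (z / x) := by gcongr
      _ = (φ w - φ v) / 2 * (x ^ 3 / (3 * z ^ 2 * (x + z))) := by field_simp; ring
      _ ≤ (φ w - φ v) / 2 * 1 := by
          gcongr
          exact (div_le_one (by positivity)).2 hcube
      _ = (φ w - φ v) / 2 := mul_one _
  have havg : 1 / z * (∫ s in v..w, φ s) ≤ (φ v + φ w) / 2 := by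
    rw [one_div, inv_mul_le_iff₀ hk']
    exact h1
  linarith

end LocalCoefficients

/-! ### Monotonicity and convexity of the weakly singular kernel -/

theorem hasDerivAt_sub_rpow (T p : ℝ) {s : ℝ} (hs : s < T) :
    HasDerivAt (fun s => (T - s) ^ p) (-p * (T - s) ^ (p - 1)) s := by
  have h := ((hasDerivAt_id s).const_sub T).rpow_const (p := p) (Or.inl (sub_pos.2 hs).ne')
  simp only [id] at h
  convert h using 1
  ring

theorem continuousOn_sub_rpow (T p : ℝ) : ContinuousOn (fun s => (T - s) ^ p) (Set.Iio T) :=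
  fun _ hs => (hasDerivAt_sub_rpow T p hs).continuousAt.continuousWithinAt

theorem monotoneOn_sub_rpow (T : ℝ) {p : ℝ} (hp : p ≤ 0) :
    MonotoneOn (fun s => (T - s) ^ p) (Set.Iio T) := by
  intro x _ y hy hxy
  exact Real.rpow_le_rpow_of_nonpos (sub_pos.2 hy) (by linarith) hp

theorem convexOn_sub_rpow (T : ℝ) {p : ℝ} (hp : p ≤ 0) :
    ConvexOn ℝ (Set.Iio T) (fun s => (T - s) ^ p) := by
  refine MonotoneOn.convexOn_of_deriv (convex_Iio T) (continuousOn_sub_rpow T p) ?_ ?_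
  · rw [interior_Iio]
    exact fun s hs => (hasDerivAt_sub_rpow T p hs).differentiableAt.differentiableWithinAt
  · rw [interior_Iio]
    intro x hx y hy hxy
    rw [(hasDerivAt_sub_rpow T p hx).deriv, (hasDerivAt_sub_rpow T p hy).deriv]
    exact mul_le_mul_of_nonneg_left (monotoneOn_sub_rpow T (by linarith) hx hy hxy) (by linarith)

theorem hasDerivAt_sub_rpow_sub {T T' : ℝ} (hT : T ≤ T') (p : ℝ) {s : ℝ} (hs : s < T) :
    HasDerivAt (fun s => (T - s) ^ p - (T' - s) ^ p)
      (-p * ((T - s) ^ (p - 1) - (T' - s) ^ (p - 1))) s := by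
  rw [mul_sub]
  exact (hasDerivAt_sub_rpow T p hs).sub (hasDerivAt_sub_rpow T' p (hs.trans_le hT))

/-- Differentiation reproduces the same kind of difference with exponent `p - 1` and factor `-p ≥
0`. Positivity of such differences gives monotonicity here, and monotonicity in turn gives convexity
below. -/
theorem monotoneOn_sub_rpow_sub {T T' : ℝ} (hT : T ≤ T') {p : ℝ} (hp : p ≤ 0) :
    MonotoneOn (fun s => (T - s) ^ p - (T' - s) ^ p) (Set.Iio T) := by
  refine monotoneOn_of_deriv_nonneg (convex_Iio T) ?_ ?_ ?_
  · exact fun s hs => (hasDerivAt_sub_rpow_sub hT p hs).continuousAt.continuousWithinAt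
  · rw [interior_Iio]
    exact fun s hs => (hasDerivAt_sub_rpow_sub hT p hs).differentiableAt.differentiableWithinAt
  · rw [interior_Iio]
    intro s hs
    rw [(hasDerivAt_sub_rpow_sub hT p hs).deriv]
    exact mul_nonneg (by linarith) (sub_nonneg.2
      (Real.rpow_le_rpow_of_nonpos (sub_pos.2 hs) (by linarith) (by linarith)))

theorem convexOn_sub_rpow_sub {T T' : ℝ} (hT : T ≤ T') {p : ℝ} (hp : p ≤ 0) :
    ConvexOn ℝ (Set.Iio T) (fun s => (T - s) ^ p - (T' - s) ^ p) := by
  refine MonotoneOn.convexOn_of_deriv (convex_Iio T) ?_ ?_ ?_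
  · exact fun s hs => (hasDerivAt_sub_rpow_sub hT p hs).continuousAt.continuousWithinAt
  · rw [interior_Iio]
    exact fun s hs => (hasDerivAt_sub_rpow_sub hT p hs).differentiableAt.differentiableWithinAt
  · rw [interior_Iio]
    intro x hx y hy hxy
    rw [(hasDerivAt_sub_rpow_sub hT p hx).deriv, (hasDerivAt_sub_rpow_sub hT p hy).deriv]
    exact mul_le_mul_of_nonneg_left (monotoneOn_sub_rpow_sub hT (by linarith) hx hy hxy)
      (by linarith)

/-- `φ` is continuous, nondecreasing and convex to the left of `T`. -/
structure IsMonotoneConvex (T : ℝ) (φ : ℝ → ℝ) : Prop where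
  continuousOn : ContinuousOn φ (Set.Iio T)
  monotoneOn : MonotoneOn φ (Set.Iio T)
  convexOn : ConvexOn ℝ (Set.Iio T) φ

theorem IsMonotoneConvex.div_const {T c : ℝ} {φ : ℝ → ℝ} (h : IsMonotoneConvex T φ) (hc : 0 ≤ c) :
    IsMonotoneConvex T (fun s => φ s / c) where
  continuousOn := h.continuousOn.div_const c
  monotoneOn := fun x hx y hy hxy => div_le_div_of_nonneg_right (h.monotoneOn hx hy hxy) hc
  convexOn := by
    have := h.convexOn.smul (inv_nonneg.2 hc)
    simpa only [smul_eq_mul, div_eq_inv_mul] using this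

theorem isMonotoneConvex_omega {α : ℝ} (hα0 : 0 < α) (hα1 : α < 1) (T : ℝ) :
    IsMonotoneConvex T (fun s => omega (1 - α) (T - s)) :=
  IsMonotoneConvex.div_const
    ⟨continuousOn_sub_rpow T _, monotoneOn_sub_rpow T (by linarith),
      convexOn_sub_rpow T (by linarith)⟩ (Real.Gamma_pos_of_pos (by linarith)).le

theorem isMonotoneConvex_omega_sub {α : ℝ} (hα0 : 0 < α) (hα1 : α < 1) {T T' : ℝ} (hT : T ≤ T') :
    IsMonotoneConvex T (fun s => omega (1 - α) (T - s) - omega (1 - α) (T' - s)) := by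
  have h : IsMonotoneConvex T (fun s => (T - s) ^ (1 - α - 1) - (T' - s) ^ (1 - α - 1)) :=
    ⟨fun s hs => (hasDerivAt_sub_rpow_sub hT _ hs).continuousAt.continuousWithinAt,
      monotoneOn_sub_rpow_sub hT (by linarith), convexOn_sub_rpow_sub hT (by linarith)⟩
  have := h.div_const (Real.Gamma_pos_of_pos (by linarith : 0 < 1 - α)).le
  simpa only [sub_div, omega] using this

theorem omega_nonneg {α : ℝ} (hα1 : α < 1) {x : ℝ} (hx : 0 ≤ x) : 0 ≤ omega (1 - α) x :=
  div_nonneg (Real.rpow_nonneg hx _) (Real.Gamma_pos_of_pos (by linarith)).le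

theorem omega_antitone {α : ℝ} (hα0 : 0 < α) (hα1 : α < 1) {x y : ℝ} (hx : 0 < x) (hxy : x ≤ y) :
    omega (1 - α) y ≤ omega (1 - α) x :=
  div_le_div_of_nonneg_right (Real.rpow_le_rpow_of_nonpos hx hxy (by linarith))
    (Real.Gamma_pos_of_pos (by linarith)).le

theorem integral_omega {α : ℝ} (hα1 : α < 1) (T u v : ℝ) :
    ∫ s in u..v, omega (1 - α) (T - s) =
      ((T - u) ^ (1 - α) - (T - v) ^ (1 - α)) / ((1 - α) * Real.Gamma (1 - α)) := by
  rw [intervalIntegral.integral_comp_sub_left (fun x => omega (1 - α) x)]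
  unfold omega
  rw [intervalIntegral.integral_div, integral_rpow (Or.inl (by linarith)), sub_add_cancel,
    div_div]

/-! ### The local coefficients for monotone convex integrands on a mesh -/

/-- The mesh conditions: positive steps and step ratios at least `4/7` up to level `N`. -/
structure IsMesh (N : ℕ) (t : ℕ → ℝ) : Prop where
  step_pos : ∀ k, 1 ≤ k → k ≤ N → 0 < step t k
  ratio_ge : ∀ k, 2 ≤ k → k ≤ N → 4 / 7 ≤ ratio t k

section Mesh

variable {N : ℕ} {t : ℕ → ℝ}

theorem IsMesh.lt (ht : IsMesh N t) {k : ℕ} (hk : 1 ≤ k) (hkN : k ≤ N) : t (k - 1) < t k := by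
  have := ht.step_pos k hk hkN
  unfold step at this
  linarith

theorem IsMesh.le (ht : IsMesh N t) {j k : ℕ} (hjk : j ≤ k) (hkN : k ≤ N) : t j ≤ t k := by
  induction k, hjk using Nat.le_induction with
  | base => exact le_rfl
  | succ k hjk ih => exact (ih (by omega)).trans (ht.lt (by omega : 1 ≤ k + 1) hkN).le

theorem IsMesh.ratio_pos (ht : IsMesh N t) {k : ℕ} (hk : 2 ≤ k) (hkN : k ≤ N) : 0 < ratio t k :=
  (by norm_num : (0 : ℝ) < 4 / 7).trans_le (ht.ratio_ge k hk hkN)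

theorem Icc_mesh_subset {k : ℕ} {u T : ℝ} (h : t k < T) : Set.Icc u (t k) ⊆ Set.Iio T :=
  fun _ hs => lt_of_le_of_lt hs.2 h

variable {T : ℝ} {φ χ : ℝ → ℝ}

theorem moment_nonneg_of_mesh (ht : IsMesh N t) {k : ℕ} (hk : 1 ≤ k) (hkN : k + 1 ≤ N)
    (hT : t k < T) (hφ : IsMonotoneConvex T φ) : 0 ≤ moment t k φ :=
  weighted_moment_nonneg (ht.step_pos k hk (by omega)) (ht.step_pos (k + 1) (by omega) hkN)
    (hφ.continuousOn.mono (Icc_mesh_subset hT)) (hφ.monotoneOn.mono (Icc_mesh_subset hT))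

theorem le_incrementCoeff (ht : IsMesh N t) {k : ℕ} (hk : 1 ≤ k) (hkN : k + 1 ≤ N)
    (hT : t k < T) (hφ : IsMonotoneConvex T φ) : φ (t (k - 1)) ≤ incrementCoeff t k φ := by
  have h1 := le_average_sub_moment (ht.step_pos k hk (by omega))
    (ht.step_pos (k + 1) (by omega) hkN) (hφ.continuousOn.mono (Icc_mesh_subset hT))
    (hφ.monotoneOn.mono (Icc_mesh_subset hT))
  unfold incrementCoeff
  split_ifs with h
  · linarith
  · have h2 : 0 ≤ moment t (k - 1) φ / ratio t k :=
      div_nonneg (moment_nonneg_of_mesh ht (by omega) (by omega)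
        ((ht.le (by omega) (by omega)).trans_lt hT) hφ) (ht.ratio_pos (by omega) (by omega)).le
    linarith

theorem average_add_moment_le_of_mesh (ht : IsMesh N t) {k : ℕ} (hk : 1 ≤ k) (hkN : k ≤ N)
    (hT : t k < T) (hφ : IsMonotoneConvex T φ) :
    average t k φ + (if k = 1 then 0 else moment t (k - 1) φ / ratio t k) ≤ φ (t k) := by
  split_ifs with h
  · rw [add_zero]
    exact average_le (ht.step_pos k hk hkN) (hφ.continuousOn.mono (Icc_mesh_subset hT))
      (hφ.monotoneOn.mono (Icc_mesh_subset hT))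
  · obtain ⟨k, rfl⟩ : ∃ j, k = j + 2 := ⟨k - 2, by omega⟩
    exact average_add_moment_le (ht.step_pos (k + 1) (by omega) (by omega))
      (ht.step_pos (k + 2) (by omega) hkN) (ht.ratio_ge (k + 2) (by omega) hkN)
      (hφ.continuousOn.mono (Icc_mesh_subset hT)) (hφ.monotoneOn.mono (Icc_mesh_subset hT))
      (hφ.convexOn.subset (Icc_mesh_subset hT) (convex_Icc _ _))

theorem incrementCoeff_le (ht : IsMesh N t) {k : ℕ} (hk : 1 ≤ k) (hkN : k + 1 ≤ N)
    (hT : t k < T) (hφ : IsMonotoneConvex T φ) : incrementCoeff t k φ ≤ φ (t k) := by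
  have h1 := average_add_moment_le_of_mesh ht hk (by omega) hT hφ
  have h2 := moment_nonneg_of_mesh ht hk hkN hT hφ
  unfold incrementCoeff
  linarith

/-- The value `φ (t (k - 1))` separates the two coefficients: it is an upper bound for the earlier
one and a lower bound for the later one. -/
theorem incrementCoeff_mono (ht : IsMesh N t) {k : ℕ} (hk : 2 ≤ k) (hkN : k + 1 ≤ N)
    (hT : t k < T) (hφ : IsMonotoneConvex T φ) :
    incrementCoeff t (k - 1) φ ≤ incrementCoeff t k φ :=
  (incrementCoeff_le ht (by omega) (by omega) ((ht.le (by omega) (by omega)).trans_lt hT) hφ).trans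
    (le_incrementCoeff ht (by omega) hkN hT hφ)

theorem incrementCoeff_sub (ht : IsMesh N t) {k : ℕ} (hk : 1 ≤ k) (hkN : k ≤ N) {T' : ℝ}
    (hT : t k < T) (hT' : t k < T') (hφ : IsMonotoneConvex T φ) (hχ : IsMonotoneConvex T' χ) :
    incrementCoeff t k (fun s => φ s - χ s) = incrementCoeff t k φ - incrementCoeff t k χ := by
  have hle := (ht.lt hk hkN).le
  unfold incrementCoeff
  rw [average_sub hle (hφ.continuousOn.mono (Icc_mesh_subset hT))
      (hχ.continuousOn.mono (Icc_mesh_subset hT')),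
    moment_sub hle (hφ.continuousOn.mono (Icc_mesh_subset hT))
      (hχ.continuousOn.mono (Icc_mesh_subset hT'))]
  split_ifs with h
  · ring
  · have hle' := ht.le (by omega : k - 1 ≤ k) hkN
    rw [moment_sub (ht.lt (by omega) (by omega)).le
      (hφ.continuousOn.mono (Icc_mesh_subset (hle'.trans_lt hT)))
      (hχ.continuousOn.mono (Icc_mesh_subset (hle'.trans_lt hT')))]
    ring

/-! ### The `L2-1_σ` kernel -/

variable {α : ℝ}

theorem lt_offset (ht : IsMesh N t) (hα1 : α < 1) {n : ℕ} (hn : 1 ≤ n) (hnN : n ≤ N) :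
    t (n - 1) < offset (α / 2) t n := by
  unfold offset
  nlinarith [ht.lt hn hnN]

theorem offset_le (ht : IsMesh N t) (hα0 : 0 < α) {n : ℕ} (hn : 1 ≤ n) (hnN : n ≤ N) :
    offset (α / 2) t n ≤ t n := by
  unfold offset
  nlinarith [ht.lt hn hnN]

theorem coeffA_eq_average (ht : IsMesh N t) (hα1 : α < 1) {n k : ℕ} (hkn : k < n) (hnN : n ≤ N) :
    coeffA α t n k = average t k (fun s => omega (1 - α) (offset (α / 2) t n - s)) := by
  have h : t k ≤ offset (α / 2) t n :=
    (ht.le (by omega : k ≤ n - 1) (by omega)).trans (lt_offset ht hα1 (by omega) hnN).le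
  rw [coeffA, average, min_eq_left h]

theorem coeffB_eq_moment (n k : ℕ) :
    coeffB α t n k = moment t k (fun s => omega (1 - α) (offset (α / 2) t n - s)) := by
  have h : offset (1 / 2) t k = (t (k - 1) + t k) / 2 := by
    unfold offset
    ring
  rw [coeffB, moment, h]

theorem kernel_of_lt (ht : IsMesh N t) (hα1 : α < 1) {n k : ℕ} (hkn : k < n) (hk : 1 ≤ k)
    (hnN : n ≤ N) :
    kernel α t n k =
      incrementCoeff t k (fun s => omega (1 - α) (offset (α / 2) t n - s)) := by
  unfold kernel incrementCoeff
  rw [if_neg (by omega), if_neg (by omega)]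
  simp only [coeffB_eq_moment]
  rw [coeffA_eq_average ht hα1 hkn hnN]
  split_ifs with h
  · subst h
    rw [coeffA_eq_average ht hα1 hkn hnN, add_zero]
  · rfl

theorem kernel_self (n : ℕ) :
    kernel α t n n = coeffA α t n n + (if n = 1 then 0 else
      moment t (n - 1) (fun s => omega (1 - α) (offset (α / 2) t n - s)) / ratio t n) := by
  unfold kernel
  rw [← coeffB_eq_moment, if_pos rfl]
  split_ifs with h
  · subst h
    rw [add_zero]
  · rfl

theorem coeffA_self (ht : IsMesh N t) (hα0 : 0 < α) (hα1 : α < 1) {n : ℕ} (hn : 1 ≤ n)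
    (hnN : n ≤ N) :
    coeffA α t n n = ((1 - α / 2) * step t n) ^ (1 - α) /
      (step t n * ((1 - α) * Real.Gamma (1 - α))) := by
  have h : offset (α / 2) t n - t (n - 1) = (1 - α / 2) * step t n := by
    unfold offset step
    ring
  rw [coeffA, min_eq_right (offset_le ht hα0 hn hnN), integral_omega hα1, h, sub_self,
    Real.zero_rpow (by linarith), sub_zero, div_mul_div_comm, one_mul]

/-- The integral covers only the fraction `1 - α / 2` of the cell, but integrating the singularity
gains `1 / (1 - α)`; the quotient of the two sides is `(1 - α / 2) / (1 - α) ≥ 1`. -/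
theorem omega_le_coeffA_self (ht : IsMesh N t) (hα0 : 0 < α) (hα1 : α < 1) {n : ℕ} (hn : 1 ≤ n)
    (hnN : n ≤ N) :
    omega (1 - α) (offset (α / 2) t n - t (n - 1)) ≤ coeffA α t n n := by
  have h : offset (α / 2) t n - t (n - 1) = (1 - α / 2) * step t n := by
    unfold offset step
    ring
  rw [coeffA_self ht hα0 hα1 hn hnN, h, omega]
  have hτ := ht.step_pos n hn hnN
  have hΓ : 0 < Real.Gamma (1 - α) := Real.Gamma_pos_of_pos (by linarith)
  have hσ : 0 < (1 - α / 2) * step t n := mul_pos (by linarith) hτ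
  have h1 : 0 < 1 - α := by linarith
  rw [Real.rpow_sub_one hσ.ne', div_div]
  refine div_le_div_of_nonneg_left (Real.rpow_nonneg hσ.le _) (mul_pos hτ (mul_pos h1 hΓ)) ?_
  rw [mul_left_comm, ← mul_assoc]
  gcongr
  linarith

theorem kernel_pred_le_kernel_self (ht : IsMesh N t) (hα0 : 0 < α) (hα1 : α < 1) {n : ℕ}
    (hn : 2 ≤ n) (hnN : n ≤ N) : kernel α t n (n - 1) ≤ kernel α t n n := by
  have hφ := isMonotoneConvex_omega hα0 hα1 (offset (α / 2) t n)
  have hT := lt_offset ht hα1 (by omega) hnN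
  rw [kernel_of_lt ht hα1 (by omega) (by omega) hnN, kernel_self, if_neg (by omega)]
  have h1 := incrementCoeff_le ht (by omega : 1 ≤ n - 1) (by omega) hT hφ
  have h2 := omega_le_coeffA_self ht hα0 hα1 (by omega : 1 ≤ n) hnN
  have h3 : 0 ≤ moment t (n - 1) (fun s => omega (1 - α) (offset (α / 2) t n - s)) / ratio t n :=
    div_nonneg (moment_nonneg_of_mesh ht (by omega) (by omega) hT hφ) (ht.ratio_pos hn hnN).le
  linarith

theorem kernel_self_nonneg (ht : IsMesh N t) (hα0 : 0 < α) (hα1 : α < 1) {n : ℕ}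
    (hn : 1 ≤ n) (hnN : n ≤ N) : 0 ≤ kernel α t n n := by
  have hφ := isMonotoneConvex_omega hα0 hα1 (offset (α / 2) t n)
  have hT := lt_offset ht hα1 (by omega) hnN
  have h1 := omega_nonneg hα1 (sub_nonneg.2 hT.le)
  have h2 := omega_le_coeffA_self ht hα0 hα1 hn hnN
  rw [kernel_self]
  split_ifs with h
  · linarith
  · have h3 : 0 ≤ moment t (n - 1) (fun s => omega (1 - α) (offset (α / 2) t n - s)) / ratio t n :=
      div_nonneg (moment_nonneg_of_mesh ht (by omega) (by omega) hT hφ)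
        (ht.ratio_pos (by omega) hnN).le
    linarith

/-- Used with `b = 1 - α`, where `2 / (1 + b) = 1 / (1 - α / 2)`. Bernoulli's inequality bounds the
left power and `(7/4)^b` from above, which leaves a rational inequality in `b` that becomes an
equality at `b = 1`. -/
theorem rpow_four_sevenths_le {b : ℝ} (hb0 : 0 < b) (hb1 : b < 1) :
    (4 / 7 + 2 / (1 + b)) ^ b ≤ 1 + (4 / 7 : ℝ) ^ b := by
  have h1 : (4 / 7 + 2 / (1 + b)) ^ b ≤ 1 + b * (4 / 7 + 2 / (1 + b) - 1) := by
    have h := rpow_one_add_le_one_add_mul_self (s := 4 / 7 + 2 / (1 + b) - 1)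
      (by have : 0 < 2 / (1 + b) := by positivity
          linarith) hb0.le hb1.le
    rwa [add_sub_cancel] at h
  have h2 : (7 / 4 : ℝ) ^ b ≤ 1 + b * (7 / 4 - 1) := by
    have h := rpow_one_add_le_one_add_mul_self (s := (7 / 4 - 1 : ℝ)) (by norm_num)
      hb0.le hb1.le
    rwa [add_sub_cancel] at h
  have h3 : (4 / 7 : ℝ) ^ b = ((7 / 4 : ℝ) ^ b)⁻¹ := by
    rw [← Real.inv_rpow (by norm_num)]
    norm_num
  have h4 : (1 + b * (7 / 4 - 1))⁻¹ ≤ ((7 / 4 : ℝ) ^ b)⁻¹ := inv_anti₀ (by positivity) h2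
  have h5 : b * (4 / 7 + 2 / (1 + b) - 1) ≤ (1 + b * (7 / 4 - 1))⁻¹ := by
    have : b * (4 / 7 + 2 / (1 + b) - 1) = b * (11 - 3 * b) / (7 * (1 + b)) := by
      field_simp
      ring
    rw [this, inv_eq_one_div, div_le_div_iff₀ (by positivity) (by positivity)]
    nlinarith [mul_pos hb0 (sub_pos.2 hb1), mul_pos hb0 hb0, mul_pos hb0 (mul_pos hb0 hb0),
      mul_pos (mul_pos hb0 hb0) (sub_pos.2 hb1)]
  rw [h3]
  linarith

/-- The average in row `n + 1` is compared with the truncated diagonal integral of row `n` by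
explicit integration. The moment over cell `n` has a favourable sign, and the moments over cell `n -
1` are ordered because the difference of the two weights is monotone. -/
theorem kernel_succ_le_kernel_self (ht : IsMesh N t) (hα0 : 0 < α) (hα1 : α < 1) {n : ℕ}
    (hn : 1 ≤ n) (hnN : n + 1 ≤ N) : kernel α t (n + 1) n ≤ kernel α t n n := by
  have hτ := ht.step_pos n hn (by omega)
  have hT : t n < offset (α / 2) t (n + 1) := lt_offset ht hα1 (by omega) hnN
  have hT' : t (n - 1) < offset (α / 2) t n := lt_offset ht hα1 hn (by omega)
  have hTT : offset (α / 2) t n ≤ offset (α / 2) t (n + 1) :=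
    (offset_le ht hα0 hn (by omega)).trans hT.le
  have hφ := isMonotoneConvex_omega hα0 hα1 (offset (α / 2) t n)
  have hχ := isMonotoneConvex_omega hα0 hα1 (offset (α / 2) t (n + 1))
  have havg : average t n (fun s => omega (1 - α) (offset (α / 2) t (n + 1) - s)) ≤
      coeffA α t n n := by
    set c := (1 - α / 2) * step t n with hc
    have hc0 : 0 < c := mul_pos (by linarith) hτ
    have hratio : 4 / 7 * step t n ≤ step t (n + 1) := by
      have h := ht.ratio_ge (n + 1) (by omega) hnN
      rwa [ratio, Nat.add_sub_cancel, le_div_iff₀ hτ] at h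
    -- Moving the singularity back to this point enlarges the weight and makes every length a
    -- multiple of `c`, so that only a power inequality in `1 - α` remains.
    have hoff : t n + 4 / 7 * c ≤ offset (α / 2) t (n + 1) := by
      have : offset (α / 2) t (n + 1) = t n + (1 - α / 2) * step t (n + 1) := by
        simp only [offset, step, Nat.add_sub_cancel]
        ring
      rw [this, hc]
      nlinarith
    have hle : t (n - 1) ≤ t n := (ht.lt hn (by omega)).le
    have hmono : ∫ s in (t (n - 1))..(t n), omega (1 - α) (offset (α / 2) t (n + 1) - s) ≤
        ∫ s in (t (n - 1))..(t n), omega (1 - α) (t n + 4 / 7 * c - s) := by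
      refine intervalIntegral.integral_mono_on hle
        ((hχ.continuousOn.mono (Icc_mesh_subset hT)).intervalIntegrable_of_Icc hle)
        (((isMonotoneConvex_omega hα0 hα1 (t n + 4 / 7 * c)).continuousOn.mono
          (Icc_mesh_subset (by linarith))).intervalIntegrable_of_Icc hle) fun s hs => ?_
      exact omega_antitone hα0 hα1 (by linarith [hs.2]) (by linarith)
    have hG : 0 < (1 - α) * Real.Gamma (1 - α) :=
      mul_pos (by linarith) (Real.Gamma_pos_of_pos (by linarith))
    have hpow : (t n + 4 / 7 * c - t (n - 1)) ^ (1 - α) - (t n + 4 / 7 * c - t n) ^ (1 - α) ≤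
        c ^ (1 - α) := by
      have e1 : t n + 4 / 7 * c - t (n - 1) = c * (4 / 7 + 2 / (1 + (1 - α))) := by
        have : t n - t (n - 1) = step t n := rfl
        have hα2 : 1 + (1 - α) ≠ 0 := by linarith
        rw [add_sub_right_comm, this, hc]
        field_simp
        ring
      have e2 : t n + 4 / 7 * c - t n = c * (4 / 7) := by ring
      have hpos : 0 < 2 / (1 + (1 - α)) := div_pos two_pos (by linarith)
      rw [e1, e2, Real.mul_rpow hc0.le (by linarith), Real.mul_rpow hc0.le (by norm_num),
        ← mul_sub]
      refine mul_le_of_le_one_right (Real.rpow_nonneg hc0.le _) ?_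
      linarith [rpow_four_sevenths_le (b := 1 - α) (by linarith) (by linarith)]
    rw [integral_omega hα1 (t n + 4 / 7 * c)] at hmono
    rw [coeffA_self ht hα0 hα1 hn (by omega), ← hc, average]
    calc 1 / step t n * ∫ s in (t (n - 1))..(t n), omega (1 - α) (offset (α / 2) t (n + 1) - s)
        ≤ 1 / step t n * (c ^ (1 - α) / ((1 - α) * Real.Gamma (1 - α))) := by
          refine mul_le_mul_of_nonneg_left (hmono.trans ?_) (by positivity)
          exact div_le_div_of_nonneg_right hpow hG.le
      _ = _ := by rw [div_mul_div_comm, one_mul]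
  rw [kernel_of_lt ht hα1 (by omega) hn hnN, kernel_self, incrementCoeff]
  have hmom := moment_nonneg_of_mesh ht hn hnN hT hχ
  split_ifs with h
  · linarith
  · have hd := moment_nonneg_of_mesh ht (by omega : 1 ≤ n - 1) (by omega) hT'
      (isMonotoneConvex_omega_sub hα0 hα1 hTT)
    rw [moment_sub (ht.lt (by omega) (by omega)).le
      (hφ.continuousOn.mono (Icc_mesh_subset hT'))
      (hχ.continuousOn.mono (Icc_mesh_subset (hT'.trans_le hTT)))] at hd
    have := div_le_div_of_nonneg_right (sub_nonneg.1 hd)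
      (ht.ratio_pos (by omega : 2 ≤ n) (by omega)).le
    linarith

/-- Rows of the kernel with doubled diagonal. -/
noncomputable def doubledKernel (α : ℝ) (t : ℕ → ℝ) (n k : ℕ) : ℝ :=
  if k = n then 2 * kernel α t n n else kernel α t n k

theorem doubledKernel_self (n : ℕ) : doubledKernel α t n n = 2 * kernel α t n n := if_pos rfl

theorem doubledKernel_of_lt {n k : ℕ} (h : k < n) : doubledKernel α t n k = kernel α t n k :=
  if_neg h.ne

/-- Differences along the rows of the kernel with doubled diagonal. -/
noncomputable def kernelDiff (α : ℝ) (t : ℕ → ℝ) (n k : ℕ) : ℝ :=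
  doubledKernel α t n k - if k = 1 then 0 else doubledKernel α t n (k - 1)

theorem sum_kernelDiff (n : ℕ) {k : ℕ} (hk : 1 ≤ k) :
    ∑ j ∈ Finset.Icc 1 k, kernelDiff α t n j = doubledKernel α t n k := by
  induction k, hk using Nat.le_induction with
  | base => simp [kernelDiff]
  | succ k hk ih =>
    rw [Finset.sum_Icc_succ_top (by omega), ih, kernelDiff, if_neg (by omega), Nat.add_sub_cancel]
    ring

theorem kernelDiff_of_lt (ht : IsMesh N t) (hα1 : α < 1) {n k : ℕ} (hkn : k < n) (hk : 1 ≤ k)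
    (hnN : n ≤ N) :
    kernelDiff α t n k = incrementCoeff t k (fun s => omega (1 - α) (offset (α / 2) t n - s)) -
      if k = 1 then 0 else
        incrementCoeff t (k - 1) (fun s => omega (1 - α) (offset (α / 2) t n - s)) := by
  unfold kernelDiff
  rw [doubledKernel_of_lt hkn, kernel_of_lt ht hα1 hkn hk hnN]
  split_ifs with h
  · rfl
  · rw [doubledKernel_of_lt (by omega), kernel_of_lt ht hα1 (by omega) (by omega) hnN]

/-- For `k < n`, linearity turns the claim into ordering of coefficients of the difference of two
weights. For `k = n ≥ 2`, doubling leaves two copies of the diagonal entry: one dominates the entry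
below it, the other the entry to its left, and the remaining entry of row `n + 1` is nonnegative. -/
theorem kernelDiff_antitone (ht : IsMesh N t) (hα0 : 0 < α) (hα1 : α < 1) {n k : ℕ}
    (hk : 1 ≤ k) (hkn : k ≤ n) (hnN : n < N) :
    kernelDiff α t (n + 1) k ≤ kernelDiff α t n k := by
  have hT : t n < offset (α / 2) t (n + 1) :=
    lt_offset ht hα1 (by omega : 1 ≤ n + 1) (by omega)
  have hT' : t (n - 1) < offset (α / 2) t n := lt_offset ht hα1 (by omega) (by omega)
  have hTT : offset (α / 2) t n ≤ offset (α / 2) t (n + 1) :=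
    (offset_le ht hα0 (by omega) (by omega)).trans hT.le
  have hφ := isMonotoneConvex_omega hα0 hα1 (offset (α / 2) t n)
  have hχ := isMonotoneConvex_omega hα0 hα1 (offset (α / 2) t (n + 1))
  rcases hkn.eq_or_lt with rfl | hlt
  · have h1 := kernel_succ_le_kernel_self ht hα0 hα1 hk hnN
    unfold kernelDiff
    rw [doubledKernel_of_lt (by omega), doubledKernel_self]
    split_ifs with h
    · linarith [kernel_self_nonneg ht hα0 hα1 hk hnN.le]
    · rw [doubledKernel_of_lt (by omega), doubledKernel_of_lt (by omega)]
      have h2 := kernel_pred_le_kernel_self ht hα0 hα1 (by omega : 2 ≤ k) hnN.le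
      have h3 := le_incrementCoeff ht (by omega : 1 ≤ k - 1) (by omega)
        ((ht.lt hk (by omega)).trans hT) hχ
      rw [← kernel_of_lt ht hα1 (by omega) (by omega) (by omega)] at h3
      have h4 := omega_nonneg hα1 (x := offset (α / 2) t (k + 1) - t (k - 1 - 1))
        (by linarith [ht.le (by omega : k - 1 - 1 ≤ k) (by omega)])
      linarith
  · have hk1 : t k < offset (α / 2) t n := (ht.le (by omega : k ≤ n - 1) (by omega)).trans_lt hT'
    have hk2 := hk1.trans_le hTT
    have hdiff := isMonotoneConvex_omega_sub hα0 hα1 hTT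
    rw [kernelDiff_of_lt ht hα1 hlt hk hnN.le, kernelDiff_of_lt ht hα1 (by omega) hk hnN]
    split_ifs with h
    -- In the first column there is no earlier coefficient; the lower bound is the difference of the
    -- weights at `t 0`, which is nonnegative.
    · have h1 := le_incrementCoeff ht hk (by omega) hk1 hdiff
      rw [incrementCoeff_sub ht hk (by omega) hk1 hk2 hφ hχ] at h1
      have h2 : t (k - 1) < t k := ht.lt hk (by omega)
      have h3 := omega_antitone hα0 hα1 (sub_pos.2 (h2.trans hk1))
        (sub_le_sub_right hTT (t (k - 1)))
      linarith
    · have h1 := incrementCoeff_mono ht (by omega : 2 ≤ k) (by omega) hk1 hdiff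
      have h2 : t (k - 1) < t k := ht.lt hk (by omega)
      rw [incrementCoeff_sub ht hk (by omega) hk1 hk2 hφ hχ,
        incrementCoeff_sub ht (by omega) (by omega) (h2.trans hk1) (h2.trans hk2) hφ hχ] at h1
      linarith

theorem kernelDiff_nonneg (ht : IsMesh N t) (hα0 : 0 < α) (hα1 : α < 1) {k : ℕ}
    (hk : 1 ≤ k) (hkN : k ≤ N) : 0 ≤ kernelDiff α t N k := by
  have hT := lt_offset ht hα1 (hk.trans hkN) le_rfl
  have hφ := isMonotoneConvex_omega hα0 hα1 (offset (α / 2) t N)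
  rcases hkN.eq_or_lt with rfl | hlt
  · have h1 := kernel_self_nonneg ht hα0 hα1 hk le_rfl
    unfold kernelDiff
    rw [doubledKernel_self]
    split_ifs with h
    · linarith
    · rw [doubledKernel_of_lt (by omega)]
      linarith [kernel_pred_le_kernel_self ht hα0 hα1 (by omega : 2 ≤ k) le_rfl]
  · have hk1 := (ht.le (by omega : k ≤ N - 1) (by omega)).trans_lt hT
    rw [kernelDiff_of_lt ht hα1 hlt hk le_rfl]
    split_ifs with h
    · have h1 := le_incrementCoeff ht hk hlt hk1 hφ
      have h2 := omega_nonneg hα1 (sub_nonneg.2 ((ht.lt hk hkN).trans hk1).le)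
      linarith
    · linarith [incrementCoeff_mono ht (by omega : 2 ≤ k) hlt hk1 hφ]

/-- The `L2-1_σ` kernel is positive semidefinite on meshes with step ratios at least `4/7`. -/
theorem kernel_form_nonneg (ht : IsMesh N t) (hα0 : 0 < α) (hα1 : α < 1) (δ : ℕ → ℝ) :
    0 ≤ ∑ n ∈ Finset.Icc 1 N, (∑ k ∈ Finset.Icc 1 n, kernel α t n k * δ k) * δ n := by
  refine triangular_form_nonneg N (kernel α t) (kernelDiff α t) δ ?_ ?_ ?_ ?_
  · intro n _ _ k hk hkn
    rw [sum_kernelDiff n hk, doubledKernel_of_lt hkn]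
  · intro n hn _
    rw [sum_kernelDiff n hn, doubledKernel_self]
  · exact fun n k hk hkn hnN => kernelDiff_antitone ht hα0 hα1 hk hkn hnN
  · exact fun k hk hkN => kernelDiff_nonneg ht hα0 hα1 hk hkN

end Mesh

/-! ### Discrete energy identities -/

section GridLemmas

variable {M : ℕ} [NeZero M]

theorem gridInner_self_nonneg (h : ℝ) (v : Grid M) : 0 ≤ gridInner h v v :=
  mul_nonneg (sq_nonneg h)
    (Finset.sum_nonneg fun _ _ => Finset.sum_nonneg fun _ _ => mul_self_nonneg _)

theorem gridGradNorm_sq (h : ℝ) (v : Grid M) :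
    gridGradNorm h v ^ 2 = gridInner h (gridGradX h v) (gridGradX h v) +
      gridInner h (gridGradY h v) (gridGradY h v) :=
  Real.sq_sqrt (add_nonneg (gridInner_self_nonneg _ _) (gridInner_self_nonneg _ _))

theorem sum_second_difference_mul (v w : ZMod M → ℝ) :
    ∑ i, (v (i + 1) + v (i - 1) - 2 * v i) * w i =
      -∑ i, (v (i + 1) - v i) * (w (i + 1) - w i) := by
  have h1 : ∑ i, v (i - 1) * w i = ∑ i, v i * w (i + 1) := by
    rw [← Equiv.sum_comp (Equiv.addRight (1 : ZMod M))]
    simp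
  have h2 : ∑ i, v (i + 1) * w (i + 1) = ∑ i, v i * w i :=
    Equiv.sum_comp (Equiv.addRight (1 : ZMod M)) fun i => v i * w i
  simp only [add_mul, sub_mul, mul_sub, Finset.sum_add_distrib, Finset.sum_sub_distrib, h1, h2,
    mul_assoc, ← Finset.mul_sum]
  ring

theorem gridInner_laplacian (h : ℝ) (v w : Grid M) :
    gridInner h (gridLaplacian h v) w = -(gridInner h (gridGradX h v) (gridGradX h w) +
      gridInner h (gridGradY h v) (gridGradY h w)) := by
  have hx : ∑ i, ∑ j, (v (i + 1) j + v (i - 1) j - 2 * v i j) * w i j =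
      -∑ i, ∑ j, (v (i + 1) j - v i j) * (w (i + 1) j - w i j) := by
    rw [Finset.sum_comm, Finset.sum_comm (f := fun i j =>
      (v (i + 1) j - v i j) * (w (i + 1) j - w i j)), ← Finset.sum_neg_distrib]
    exact Finset.sum_congr rfl fun j _ =>
      sum_second_difference_mul (fun i => v i j) (fun i => w i j)
  have hy : ∑ i, ∑ j, (v i (j + 1) + v i (j - 1) - 2 * v i j) * w i j =
      -∑ i, ∑ j, (v i (j + 1) - v i j) * (w i (j + 1) - w i j) := by
    rw [← Finset.sum_neg_distrib]
    exact Finset.sum_congr rfl fun i _ => sum_second_difference_mul (v i) (w i)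
  have e1 : ∑ i, ∑ j, gridLaplacian h v i j * w i j =
      (∑ i, ∑ j, (v (i + 1) j + v (i - 1) j - 2 * v i j) * w i j +
        ∑ i, ∑ j, (v i (j + 1) + v i (j - 1) - 2 * v i j) * w i j) / h ^ 2 := by
    simp only [← Finset.sum_add_distrib, Finset.sum_div]
    refine Finset.sum_congr rfl fun i _ => Finset.sum_congr rfl fun j _ => ?_
    unfold gridLaplacian
    ring
  have e2 : ∑ i, ∑ j, gridGradX h v i j * gridGradX h w i j =
      (∑ i, ∑ j, (v (i + 1) j - v i j) * (w (i + 1) j - w i j)) / h ^ 2 := by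
    simp only [Finset.sum_div]
    refine Finset.sum_congr rfl fun i _ => Finset.sum_congr rfl fun j _ => ?_
    unfold gridGradX
    ring
  have e3 : ∑ i, ∑ j, gridGradY h v i j * gridGradY h w i j =
      (∑ i, ∑ j, (v i (j + 1) - v i j) * (w i (j + 1) - w i j)) / h ^ 2 := by
    simp only [Finset.sum_div]
    refine Finset.sum_congr rfl fun i _ => Finset.sum_congr rfl fun j _ => ?_
    unfold gridGradY
    ring
  unfold gridInner
  rw [e1, e2, e3, hx, hy]
  ring

/-- Twice the weighted value is `(v + w) + (1 - 2ς)(v - w)`; the last term is dissipative when `ς ≤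
1/2`. -/
theorem gridInner_weighted_sub (h ς : ℝ) (v w : Grid M) :
    2 * gridInner h (weighted ς v w) (v - w) = gridInner h v v - gridInner h w w +
      (1 - 2 * ς) * gridInner h (v - w) (v - w) := by
  unfold gridInner weighted
  simp only [Finset.mul_sum, ← Finset.sum_add_distrib, ← Finset.sum_sub_distrib]
  refine Finset.sum_congr rfl fun i _ => Finset.sum_congr rfl fun j _ => ?_
  simp only [Pi.sub_apply]
  ring

theorem gridInner_add_left (h : ℝ) (u v w : Grid M) :
    gridInner h (u + v) w = gridInner h u w + gridInner h v w := by
  simp only [gridInner, Pi.add_apply, add_mul, Finset.sum_add_distrib, mul_add]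

theorem gridInner_smul_left (h c : ℝ) (v w : Grid M) :
    gridInner h (c • v) w = c * gridInner h v w := by
  simp only [gridInner, Pi.smul_apply, smul_eq_mul, Finset.mul_sum]
  refine Finset.sum_congr rfl fun i _ => Finset.sum_congr rfl fun j _ => ?_
  ring

theorem gridInner_smul_right (h c : ℝ) (v w : Grid M) :
    gridInner h v (c • w) = c * gridInner h v w := by
  simp only [gridInner, Pi.smul_apply, smul_eq_mul, Finset.mul_sum]
  refine Finset.sum_congr rfl fun i _ => Finset.sum_congr rfl fun j _ => ?_
  ring

theorem gridGradNorm_sq_sub_le {ς : ℝ} (hς : ς ≤ 1 / 2) (h : ℝ) (v w : Grid M) :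
    gridGradNorm h v ^ 2 - gridGradNorm h w ^ 2 ≤
      -(2 * gridInner h (gridLaplacian h (weighted ς v w)) (v - w)) := by
  have ex : gridGradX h (weighted ς v w) = weighted ς (gridGradX h v) (gridGradX h w) := by
    funext i j
    unfold gridGradX weighted
    ring
  have ey : gridGradY h (weighted ς v w) = weighted ς (gridGradY h v) (gridGradY h w) := by
    funext i j
    unfold gridGradY weighted
    ring
  have sx : gridGradX h (v - w) = gridGradX h v - gridGradX h w := by
    funext i j
    simp only [gridGradX, Pi.sub_apply]
    ring
  have sy : gridGradY h (v - w) = gridGradY h v - gridGradY h w := by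
    funext i j
    simp only [gridGradY, Pi.sub_apply]
    ring
  rw [gridInner_laplacian, ex, ey, sx, sy, gridGradNorm_sq, gridGradNorm_sq]
  have hx := gridInner_weighted_sub h ς (gridGradX h v) (gridGradX h w)
  have hy := gridInner_weighted_sub h ς (gridGradY h v) (gridGradY h w)
  have px := mul_nonneg (by linarith : 0 ≤ 1 - 2 * ς)
    (gridInner_self_nonneg h (gridGradX h v - gridGradX h w))
  have py := mul_nonneg (by linarith : 0 ≤ 1 - 2 * ς)
    (gridInner_self_nonneg h (gridGradY h v - gridGradY h w))
  linarith

/-- The discrete Caputo derivative is nonnegative in the mean when tested with the increments. -/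
theorem sum_gridInner_caputoL21_nonneg {N : ℕ} {t : ℕ → ℝ} (ht : IsMesh N t) {α : ℝ}
    (hα0 : 0 < α) (hα1 : α < 1) (h : ℝ) (w : ℕ → Grid M) :
    0 ≤ ∑ n ∈ Finset.Icc 1 N, gridInner h (caputoL21 α t w n) (w n - w (n - 1)) := by
  unfold gridInner
  rw [← Finset.mul_sum, Finset.sum_comm]
  refine mul_nonneg (sq_nonneg h) (Finset.sum_nonneg fun i _ => ?_)
  rw [Finset.sum_comm]
  refine Finset.sum_nonneg fun j _ => ?_
  -- The kernel does not depend on the grid point, so the scalar form applies at each point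
  -- separately.
  have key := kernel_form_nonneg ht hα0 hα1 fun k => w k i j - w (k - 1) i j
  simpa [caputoL21, Finset.sum_apply] using key

/-- One step of the scheme changes the modified energy by at most the discrete Caputo derivative
tested with the increment. -/
theorem IsSolution.energy_sub_le {α m ε κ β h : ℝ} {F f : ℝ → ℝ} {D : Set ℝ} {V : ℝ → ℝ} {N : ℕ}
    {t : ℕ → ℝ} {φhat φ : ℕ → Grid M} {R : ℕ → ℝ}
    (hsol : IsSolution α m ε κ β h F f D V N t φhat φ R) (hα1 : α < 1) (hm : 0 < m)
    (ht : IsMesh N t) {n : ℕ} (hn : 1 ≤ n) (hnN : n ≤ N) :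
    energy ε h (φ n) (R n) - energy ε h (φ (n - 1)) (R (n - 1)) ≤
      -(1 / m * gridInner h (caputoL21 α t φ n) (φ n - φ (n - 1))) := by
  have hphase := hsol.phase n hn hnN
  have haux := hsol.auxiliary n hn hnN
  simp only at hphase haux
  have hτ := (ht.step_pos n hn hnN).ne'
  generalize V (gFun F h (weighted (α / 2) (φhat n) (φ (n - 1))) (R (n - 1))) = Vς at *
  generalize weighted (α / 2) (φhat n) (φ (n - 1)) = ψ at *
  have hgrad := gridGradNorm_sq_sub_le (by linarith : α / 2 ≤ 1 / 2) h (φ n) (φ (n - 1))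
  generalize weighted (α / 2) (φ n) (φ (n - 1)) = χ at *
  have hR : R n - R (n - 1) =
      Vς * gridInner h (-gridMap f ψ + κ • (χ - ψ)) (φ n - φ (n - 1)) := by
    rw [gridInner_smul_right] at haux
    field_simp at haux
    exact haux
  -- This exposes the grid function from the update of `R`, so testing with the increment gives `-(R
  -- n - R (n - 1))` exactly.
  have hsplit : ε ^ 2 • gridLaplacian h χ + Vς • gridMap f ψ - (κ * Vς) • (χ - ψ) =
      ε ^ 2 • gridLaplacian h χ + (-Vς) • (-gridMap f ψ + κ • (χ - ψ)) := by
    funext i j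
    simp only [Pi.add_apply, Pi.sub_apply, Pi.smul_apply, Pi.neg_apply, smul_eq_mul]
    ring
  rw [hphase, hsplit, gridInner_smul_left, gridInner_add_left, gridInner_smul_left,
    gridInner_smul_left, one_div, inv_mul_cancel_left₀ hm.ne', neg_mul, ← hR]
  unfold energy
  nlinarith [sq_nonneg ε]

end GridLemmas

end TFAC

/-! ### The energy law -/

theorem mainTheorem4
    -- physical and discretization parameters
    (α m ε κ L : ℝ) (hα0 : 0 < α) (hα1 : α < 1) (hm : 0 < m) (hε : 0 < ε) (hL : 0 < L)
    (M : ℕ) [NeZero M] (h : ℝ) (hh : h = L / M)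
    -- the potential and the auxiliary function
    (F f : ℝ → ℝ) (D : Set ℝ) (β : ℝ) (hF : TFAC.IsPotential F f D β)
    (V : ℝ → ℝ) (K₁ K₂ : ℝ) (hV : TFAC.IsAuxiliary V K₁ K₂)
    -- the stabilizing constant dominates the maximum of |f'| on [-β, β]
    (hκ : ∀ x ∈ Set.Icc (-β) β, |deriv f x| ≤ κ)
    -- the time mesh 0 = t₀ < t₁ < ⋯ < t_N
    (N : ℕ) (t : ℕ → ℝ) (ht0 : t 0 = 0) (htmono : ∀ k, k < N → t k < t (k + 1))
    -- the step-ratio condition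
    (hr : ∀ k, 2 ≤ k → k ≤ N → 4 / 7 ≤ TFAC.ratio t k)
    -- the two restrictions on the first step (the second one is void for κ = 0)
    (hτ₁ : 1 ≤ N → TFAC.step t 1 ≤
      (4 / (11 * (α / 2) * m * (κ + 4 * ε ^ 2 / h ^ 2) * Real.Gamma (2 - α))) ^ (1 / α))
    (hτ₁' : 1 ≤ N → κ ≠ 0 → TFAC.step t 1 ≤
      (4 / (11 * κ * (1 - α / 2) * m * Real.Gamma (2 - α))) ^ (1 / α))
    -- a solution of the scheme
    (φhat φ : ℕ → TFAC.Grid M) (R : ℕ → ℝ)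
    (hsol : TFAC.IsSolution α m ε κ β h F f D V N t φhat φ R) :
    ∀ n, 1 ≤ n → n ≤ N → TFAC.energy ε h (φ n) (R n) ≤ TFAC.energy ε h (φ 0) (R 0) := by
  intro n hn hnN
  have hmeshN : TFAC.IsMesh N t := by
    refine ⟨fun k hk hkn => ?_, hr⟩
    have := htmono (k - 1) (by omega)
    rw [Nat.sub_add_cancel hk] at this
    exact sub_pos.2 this
  -- The mesh is cut at level `n` because semidefiniteness is needed for the form summed up to `n`,
  -- whose last row is row `n`.
  have hmesh : TFAC.IsMesh n t :=
    ⟨fun k hk hkn => hmeshN.step_pos k hk (hkn.trans hnN), fun k hk hkn => hr k hk (hkn.trans hnN)⟩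
  have hpsd := TFAC.sum_gridInner_caputoL21_nonneg hmesh hα0 hα1 h φ
  have hsum : ∀ p, p ≤ N → TFAC.energy ε h (φ p) (R p) - TFAC.energy ε h (φ 0) (R 0) ≤
      -(1 / m * ∑ k ∈ Finset.Icc 1 p,
        TFAC.gridInner h (TFAC.caputoL21 α t φ k) (φ k - φ (k - 1))) := by
    intro p
    induction p with
    | zero => simp
    | succ p ih =>
      intro hp
      have h1 := ih (by omega)
      have h2 := hsol.energy_sub_le hα1 hm hmeshN (by omega : 1 ≤ p + 1) hp
      rw [Finset.sum_Icc_succ_top (by omega : 1 ≤ p + 1), mul_add]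
      rw [Nat.add_sub_cancel] at h2 ⊢
      linarith
  have h1 := hsum n hnN
  have h2 : 0 ≤ 1 / m * ∑ k ∈ Finset.Icc 1 n,
      TFAC.gridInner h (TFAC.caputoL21 α t φ k) (φ k - φ (k - 1)) :=
    mul_nonneg (by positivity) hpsd
  linarith
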